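/- Let $E$ be a Borel space, i.e. a topological space homeomorphic to a Borel subset of a Polish space, let $\mathcal B(E)$ be its Borel $\sigma$-field, $\mathcal P(E)$ the space of Borel probability measures on $E$ with the topology of weak convergence, and $\mathcal A(E)$ the $\sigma$-field generated by the analytic subsets of $E$. A function $g:E\to[-\infty,\infty]$ is upper semianalytic if $\{g>c\}$ is analytic for every $c\in\mathbb R$. A gambling house is an analytic set $J\subseteq E\times\mathcal P(E)$ whose sections $J_x=\{\mu:(x,\mu)\in J\}$ are nonempty for every $x\in E$. For $f:E\to[0,\infty]$ write $\langle\mu,f\rangle=\int f\,d\mu\in[0,\infty]$ and $Jf(x)=\sup_{\mu\in J_x}\langle\mu,f\rangle$ (upper semianalytic functions being integrated with respect to the completion of $\mu$). A $J$-admissible kernel is a family $\lambda=(\lambda(x,\cdot))_{x\in E}$ of Borel probability measures on $E$ such that $x\mapsto\lambda(x,B)$ is $\mathcal A(E)$-measurable for every $B\in\mathcal B(E)$ and $(x,\lambda(x,\cdot))\in J$ for every $x\in E$. For $m\in\mathcal P(E)$ let $(m\otimes\lambda)(B)=\int_E\lambda(x,B)\,m(dx)$ for $B\in\mathcal B(E)$.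 For gambling houses $J,K$ let $$m\otimes K=\{m\otimes\lambda:\lambda\ K\text{-admissible}\},\qquad J\otimes K=\{(x,\nu):\nu\in\mu\otimes K\text{ for some }\mu\in J_x\},$$ and, for $n\ge1$ gambling houses, $J^1\otimes\cdots\otimes J^n=J^1\otimes(\cdots\otimes(J^{n-1}\otimes J^n))$. Let $\Phi:E\to[0,\infty]$ be upper semianalytic. Then: (i) for every gambling house $J$, the function $J\Phi:E\to[0,\infty]$ is upper semianalytic, and for every $m\in\mathcal P(E)$ $$\sup_{\mu\in m\otimes J}\langle\mu,\Phi\rangle=\int_E J\Phi(x)\,m(dx);$$ (ii) for all $n\ge1$ and gambling houses $J^1,\dots,J^n$, the set $J^1\otimes\cdots\otimes J^n$ is a gambling house and $$(J^1\otimes\cdots\otimes J^n)(\Phi)=J^1(\cdots J^{n-1}(J^n(\Phi))).$$ -/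

import Mathlib

open MeasureTheory
open scoped ENNReal

namespace GamblingHouse

universe u

/-- A *Borel space*: a topological space that is homeomorphic to a Borel subset of a Polish
space. -/
def IsBorelSubsetOfPolish (E : Type u) [TopologicalSpace E] : Prop :=
  ∃ (X : Type u) (_ : TopologicalSpace X) (_ : PolishSpace X) (e : E → X),
    Topology.IsEmbedding e ∧ MeasurableSet[borel X] (Set.range e)

/-- Upper semianalytic functions: every strict superlevel set at a real level is analytic. -/
def UpperSemianalytic {E : Type u} [TopologicalSpace E] (g : E → EReal) : Prop :=
  ∀ c : ℝ, AnalyticSet {x | (c : EReal) < g x}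

/-- The σ-field `𝒜(E)` generated by the analytic subsets of `E`. -/
@[reducible] def analyticSigma (E : Type u) [TopologicalSpace E] : MeasurableSpace E :=
  MeasurableSpace.generateFrom {s | AnalyticSet s}

variable {E : Type u} [TopologicalSpace E] [MeasurableSpace E] [BorelSpace E]

/-- A gambling house: an analytic subset of `E × 𝒫(E)` (where `𝒫(E)` has the topology of weak
convergence) all of whose sections are nonempty. -/
structure IsHouse (J : Set (E × ProbabilityMeasure E)) : Prop where
  analytic : AnalyticSet J
  nonempty_section : ∀ x, ∃ μ, (x, μ) ∈ J

/-- The pairing `⟨μ, f⟩ = ∫ f dμ` with values in `[0, ∞]`. Upper semianalytic functions are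
measurable for the completion of every `μ`, and the lower Lebesgue integral is then the integral
with respect to that completion. -/
noncomputable def pairing (μ : ProbabilityMeasure E) (f : E → ℝ≥0∞) : ℝ≥0∞ :=
  ∫⁻ x, f x ∂(μ : Measure E)

/-- The supremum of `⟨μ, f⟩` over a set of probability measures. -/
noncomputable def supPairing (S : Set (ProbabilityMeasure E)) (f : E → ℝ≥0∞) : ℝ≥0∞ :=
  ⨆ μ ∈ S, pairing μ f

/-- The maximal expected gain `J f (x) = sup {⟨μ, f⟩ | μ ∈ J_x}`. -/
noncomputable def gain (J : Set (E × ProbabilityMeasure E)) (f : E → ℝ≥0∞) : E → ℝ≥0∞ :=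
  fun x => supPairing {μ | (x, μ) ∈ J} f

/-- `κ` is a `J`-admissible (analytic) kernel: each `κ x` is a probability measure on the Borel sets,
`x ↦ κ x B` is `𝒜(E)`-measurable for every Borel set `B`, and `(x, κ x) ∈ J` for every `x`. -/
structure IsAdmissible (J : Set (E × ProbabilityMeasure E)) (κ : E → ProbabilityMeasure E) :
    Prop where
  measurable : ∀ B : Set E, MeasurableSet B →
    Measurable[analyticSigma E] (fun x => (κ x : Measure E) B)
  mem : ∀ x, (x, κ x) ∈ J

/-- `ν` is the composition `m ⊗ κ`, i.e. `ν(B) = ∫ κ(x, B) m(dx)` for every Borel set `B`. -/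
def IsComposition (m : ProbabilityMeasure E) (κ : E → ProbabilityMeasure E)
    (ν : ProbabilityMeasure E) : Prop :=
  ∀ B : Set E, MeasurableSet B → (ν : Measure E) B = pairing m (fun x => (κ x : Measure E) B)

/-- `m ⊗ K = {m ⊗ κ | κ a K-admissible kernel}`. -/
def measureComp (m : ProbabilityMeasure E) (K : Set (E × ProbabilityMeasure E)) :
    Set (ProbabilityMeasure E) :=
  {ν | ∃ κ, IsAdmissible K κ ∧ IsComposition m κ ν}

/-- `J ⊗ K = {(x, ν) | ν ∈ μ ⊗ K for some μ ∈ J_x}`. -/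
def houseComp (J K : Set (E × ProbabilityMeasure E)) : Set (E × ProbabilityMeasure E) :=
  {p | ∃ μ, (p.1, μ) ∈ J ∧ p.2 ∈ measureComp μ K}

/-- `J 0 ⊗ (J 1 ⊗ (⋯ ⊗ J n))`, the composition of a nonempty finite sequence of houses. -/
def houseCompSeq : (n : ℕ) → (Fin (n + 1) → Set (E × ProbabilityMeasure E)) →
    Set (E × ProbabilityMeasure E)
  | 0, J => J 0
  | n + 1, J => houseComp (J 0) (houseCompSeq n (fun i => J i.succ))

/-- `J 0 (J 1 (⋯ (J n f)))`. -/
noncomputable def gainSeq : (n : ℕ) → (Fin (n + 1) → Set (E × ProbabilityMeasure E)) →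
    (E → ℝ≥0∞) → E → ℝ≥0∞
  | 0, J, f => gain (J 0) f
  | n + 1, J, f => gain (J 0) (gainSeq n (fun i => J i.succ) f)

end GamblingHouse

/-!
A nonempty analytic set is the image of Baire space under a continuous map `f`. By capacitability
a finite measure of it is the supremum over `τ` of the measures of the compact sets `f '' Iic τ`;
hence analytic sets are universally measurable, and `t ↦ κ t A` is upper semianalytic for every
kernel `κ` and every analytic set `A`. Writing an integral as the measure of a hypograph, the same
holds for `μ ↦ ⟨μ, Φ⟩`, so `JΦ` is upper semianalytic, being a supremum over the sections of the
analytic set `J`. The inequality `≤` in (i) is Fubini's theorem. For `≥`, take a simple function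
`φ ≤ JΦ` and uniformize the analytic set `{(x, μ) ∈ J | φ x - ε < ⟨μ, Φ⟩}` by the Jankov-von
Neumann selection theorem: the selection is an admissible kernel within `ε` of `φ`.

For (ii) the point is that `J ⊗ K` is analytic. A measure `ν` belongs to `μ ⊗ K` exactly when some
law `γ` on `E × E` has marginals `μ` and `ν` and a disintegration lying in `K` almost everywhere:
an admissible kernel may be replaced by a Borel kernel off a `μ`-null set. Since disintegrations
can be chosen jointly measurable in `γ` and the base point, this condition on `γ` is analytic, and
`J ⊗ K` is a measurable image. The identity then follows from (i) by induction.
-/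

namespace GamblingHouse

open Set Filter Topology TopologicalSpace ProbabilityTheory

section WeakConvergence

variable {X Y : Type*} [TopologicalSpace X] [MeasurableSpace X]

theorem lowerSemicontinuous_measure_of_isOpen [OpensMeasurableSpace X] [HasOuterApproxClosed X]
    {U : Set X} (hU : IsOpen U) :
    LowerSemicontinuous fun μ : ProbabilityMeasure X ↦ (μ : Measure X) U := fun _ _ hc ↦
  eventually_lt_of_lt_liminf
    (hc.trans_le (ProbabilityMeasure.le_liminf_measure_open_of_tendsto tendsto_id hU))

theorem isInducing_probabilityMeasure_map [OpensMeasurableSpace X] [TopologicalSpace Y]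
    [MeasurableSpace Y] [BorelSpace Y] [HasOuterApproxClosed Y]
    [FirstCountableTopology (ProbabilityMeasure Y)] {e : X → Y} (he : IsInducing e) :
    IsInducing fun μ : ProbabilityMeasure X ↦ μ.map he.continuous.measurable.aemeasurable := by
  let P (μ : ProbabilityMeasure X) := μ.map he.continuous.measurable.aemeasurable
  refine isInducing_iff_nhds.2 fun μ ↦ le_antisymm
    ((ProbabilityMeasure.continuous_map he.continuous).tendsto μ).le_comap ?_
  change Tendsto id (comap P (𝓝 (P μ))) (𝓝 μ)
  refine tendsto_of_forall_isOpen_le_liminf' fun U hU ↦ ?_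
  obtain ⟨V, hV, rfl⟩ := he.isOpen_iff.1 hU
  have hP (ν : ProbabilityMeasure X) : (P ν : Measure Y) V = (ν : Measure X) (e ⁻¹' V) :=
    ν.map_apply' _ hV.measurableSet
  simpa only [hP, id] using ProbabilityMeasure.le_liminf_measure_open_of_tendsto
    (tendsto_comap : Tendsto P (comap P (𝓝 (P μ))) _) hV

instance [SecondCountableTopology X] [MetrizableSpace X] [OpensMeasurableSpace X] :
    SecondCountableTopology (ProbabilityMeasure X) := by
  let := metrizableSpaceMetric X
  obtain ⟨e, he⟩ := Metric.PiNatEmbed.exists_embedding_to_hilbert_cube (X := X)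
  let := pseudoMetrizableSpacePseudoMetric (ProbabilityMeasure (ℕ → unitInterval))
  exact (isInducing_probabilityMeasure_map he.isInducing).secondCountableTopology

theorem measurableSpace_probabilityMeasure_le_borel [BorelSpace X] [HasOuterApproxClosed X] :
    (inferInstance : MeasurableSpace (ProbabilityMeasure X)) ≤ borel (ProbabilityMeasure X) := by
  borelize (ProbabilityMeasure X)
  refine Measurable.comap_le (f := fun μ : ProbabilityMeasure X ↦ (μ : Measure X)) <|
    .measure_of_isPiSystem_of_isProbabilityMeasure BorelSpace.measurable_eq isPiSystem_isOpen
    fun U hU ↦ (lowerSemicontinuous_measure_of_isOpen hU).measurable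

variable [OpensMeasurableSpace X]

theorem topologicalSpace_probabilityMeasure_eq_iInf :
    (inferInstance : TopologicalSpace (ProbabilityMeasure X)) =
      ⨅ f : BoundedContinuousFunction X NNReal,
        .induced (fun μ ↦ ∫⁻ x, f x ∂(μ : Measure X)) inferInstance := by
  refine le_antisymm (le_iInf fun f ↦ continuous_iff_le_induced.1 <|
    ProbabilityMeasure.continuous_iff_forall_continuous_lintegral.1 continuous_id f) ?_
  refine continuous_id_iff_le.1 <|
    (@ProbabilityMeasure.continuous_iff_forall_continuous_lintegral _ _ _ _ _ (_) id).2 fun f ↦ ?_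
  exact continuous_iff_le_induced.2 (iInf_le _ f)

theorem borel_probabilityMeasure_le [SecondCountableTopology (ProbabilityMeasure X)] :
    borel (ProbabilityMeasure X) ≤ (inferInstance : MeasurableSpace (ProbabilityMeasure X)) := by
  rw [borel_eq_generateFrom_of_subbasis <|
    topologicalSpace_probabilityMeasure_eq_iInf.trans (generateFrom_iUnion_isOpen _).symm]
  refine MeasurableSpace.generateFrom_le fun s hs ↦ ?_
  obtain ⟨f, V, hV, rfl⟩ := mem_iUnion.1 hs
  exact (Measure.measurable_lintegral f.continuous.measurable.coe_nnreal_ennreal).comp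
    measurable_subtype_coe hV.measurableSet

instance [SecondCountableTopology X] [MetrizableSpace X] [BorelSpace X] :
    BorelSpace (ProbabilityMeasure X) :=
  ⟨measurableSpace_probabilityMeasure_le_borel.antisymm borel_probabilityMeasure_le⟩

end WeakConvergence

section StandardBorel

variable {X Y : Type*} [MeasurableSpace X] [MeasurableSpace Y]

theorem standardBorelSpace_of_measurableEquiv [StandardBorelSpace Y] (e : X ≃ᵐ Y) :
    StandardBorelSpace X := by
  let := upgradeStandardBorel Y
  refine ⟨.induced e inferInstance, @BorelSpace.mk _ (.induced e inferInstance) _ ?_,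
    e.toEquiv.polishSpace_induced⟩
  rw [borel_comap, ← BorelSpace.measurable_eq (α := Y)]
  exact e.measurableEmbedding.comap_eq.symm

theorem standardBorelSpace_of_measurableEmbedding [StandardBorelSpace Y] {e : X → Y}
    (he : MeasurableEmbedding e) : StandardBorelSpace X :=
  have := he.measurableSet_range.standardBorel
  standardBorelSpace_of_measurableEquiv he.equivRange

theorem measurable_probabilityMeasure_map {f : X → Y} (hf : Measurable f) :
    Measurable fun μ : ProbabilityMeasure X ↦ μ.map hf.aemeasurable :=
  ((Measure.measurable_map f hf).comp measurable_subtype_coe).subtype_mk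

theorem measurable_measure_coe {s : Set X} (hs : MeasurableSet s) :
    Measurable fun μ : ProbabilityMeasure X ↦ (μ : Measure X) s :=
  (Measure.measurable_coe hs).comp measurable_subtype_coe

theorem range_probabilityMeasure_map {e : X → Y} (he : MeasurableEmbedding e) :
    range (fun μ : ProbabilityMeasure X ↦ μ.map he.measurable.aemeasurable) =
      {ν : ProbabilityMeasure Y | (ν : Measure Y) (range e) = 1} := by
  ext ν
  constructor
  · rintro ⟨μ, rfl⟩
    simp [he.map_apply]
  · intro hν
    refine ⟨⟨(ν : Measure Y).comap e, ⟨by simpa [he.comap_apply] using hν⟩⟩, Subtype.ext ?_⟩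
    exact (he.map_comap _).trans
      (Measure.restrict_eq_self_of_ae_mem ((mem_ae_iff_prob_eq_one he.measurableSet_range).2 hν))

theorem measurableEmbedding_probabilityMeasure_map {e : X → Y} (he : MeasurableEmbedding e) :
    MeasurableEmbedding fun μ : ProbabilityMeasure X ↦ μ.map he.measurable.aemeasurable := by
  let P (μ : ProbabilityMeasure X) := μ.map he.measurable.aemeasurable
  have hP : Measurable P := measurable_probabilityMeasure_map he.measurable
  refine MeasurableEmbedding.iff_comap_eq.2 ⟨fun μ ν h ↦ ?_, hP.comap_le.antisymm ?_, ?_⟩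
  · have h' : (μ : Measure X).map e = (ν : Measure X).map e := congrArg Subtype.val h
    exact Subtype.ext ((he.comap_map _).symm.trans (h' ▸ he.comap_map _))
  · refine Measurable.comap_le (f := fun μ : ProbabilityMeasure X ↦ (μ : Measure X))
      (@Measure.measurable_of_measurable_coe _ _ _ (.comap P inferInstance) _ fun s hs ↦ ?_)
    have h (μ : ProbabilityMeasure X) : (P μ : Measure Y) (e '' s) = (μ : Measure X) s := by
      rw [μ.map_apply' _ (he.measurableSet_image.2 hs), he.injective.preimage_image]
    simp only [← h]
    exact (measurable_measure_coe (he.measurableSet_image.2 hs)).comp (comap_measurable P)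
  · rw [range_probabilityMeasure_map he]
    exact measurableSet_eq_fun (measurable_measure_coe he.measurableSet_range) measurable_const

instance [StandardBorelSpace X] : StandardBorelSpace (ProbabilityMeasure X) :=
  have : PolishSpace (ProbabilityMeasure unitInterval) := by
    let := metrizableSpaceMetric (ProbabilityMeasure unitInterval)
    infer_instance
  standardBorelSpace_of_measurableEmbedding <|
    measurableEmbedding_probabilityMeasure_map (measurableEmbedding_sigmoid_comp_embeddingReal X)

theorem IsBorelSubsetOfPolish.standard {E : Type*} [TopologicalSpace E] [MeasurableSpace E]
    [BorelSpace E] (hE : IsBorelSubsetOfPolish E) :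
    SecondCountableTopology E ∧ MetrizableSpace E ∧ StandardBorelSpace E := by
  obtain ⟨X, _, _, e, he, hr⟩ := hE
  borelize X
  exact ⟨he.secondCountableTopology, he.metrizableSpace,
    standardBorelSpace_of_measurableEmbedding (he.measurableEmbedding hr)⟩

end StandardBorel

section AnalyticSets

variable {X Y : Type*} [TopologicalSpace X] [TopologicalSpace Y]

theorem exists_continuous_range_eq_of_analyticSet {s : Set X} (hs : AnalyticSet s)
    (hne : s.Nonempty) : ∃ f : (ℕ → ℕ) → X, Continuous f ∧ range f = s := by
  rw [AnalyticSet] at hs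
  exact hs.resolve_left hne.ne_empty

theorem analyticSet_inter [T2Space X] {s t : Set X} (hs : AnalyticSet s) (ht : AnalyticSet t) :
    AnalyticSet (s ∩ t) := by
  rw [inter_eq_iInter]
  exact AnalyticSet.iInter (by rintro (_ | _) <;> assumption)

variable [MeasurableSpace X] [MeasurableSpace Y]

theorem analyticSet_of_measurableSet [SecondCountableTopology X] [OpensMeasurableSpace X]
    [StandardBorelSpace X] {s : Set X} (hs : MeasurableSet s) : AnalyticSet s := by
  simpa only [image_id] using hs.analyticSet_image measurable_id

theorem analyticSet_image_of_measurable [BorelSpace X] [SecondCountableTopology Y]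
    [OpensMeasurableSpace Y] {s : Set X} (hs : AnalyticSet s) {f : X → Y} (hf : Measurable f) :
    AnalyticSet (f '' s) := by
  rcases s.eq_empty_or_nonempty with rfl | hne
  · simpa only [image_empty] using analyticSet_empty
  obtain ⟨g, hg, rfl⟩ := exists_continuous_range_eq_of_analyticSet hs hne
  rw [← range_comp, ← image_univ]
  exact MeasurableSet.univ.analyticSet_image (hf.comp hg.measurable)

theorem analyticSet_preimage_of_measurable [SecondCountableTopology X] [OpensMeasurableSpace X]
    [StandardBorelSpace X] [BorelSpace Y] [MeasurableEq Y] {s : Set Y} (hs : AnalyticSet s)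
    {f : X → Y} (hf : Measurable f) : AnalyticSet (f ⁻¹' s) := by
  rcases s.eq_empty_or_nonempty with rfl | hne
  · simpa only [preimage_empty] using analyticSet_empty
  obtain ⟨g, hg, rfl⟩ := exists_continuous_range_eq_of_analyticSet hs hne
  have hgraph : MeasurableSet {p : X × (ℕ → ℕ) | f p.1 = g p.2} :=
    measurableSet_eq_fun (hf.comp measurable_fst) (hg.measurable.comp measurable_snd)
  convert hgraph.analyticSet_image measurable_fst
  ext x
  simp [eq_comm]

end AnalyticSets

section BaireSpace

/-- Sequences whose initial segment of the length of `s` is pointwise bounded by `s`. As in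
`PiNat.res`, initial segments are listed in reverse order. The images of these sets under a
continuous map are the stages of the capacitability argument. -/
def boundedBy (s : List ℕ) : Set (ℕ → ℕ) :=
  {σ | List.Forall₂ (· ≤ ·) (PiNat.res σ s.length) s}

theorem boundedBy_nil : boundedBy [] = univ := by
  simp [boundedBy]

theorem mem_boundedBy_cons {k : ℕ} {s : List ℕ} {σ : ℕ → ℕ} :
    σ ∈ boundedBy (k :: s) ↔ σ s.length ≤ k ∧ σ ∈ boundedBy s := by
  simp [boundedBy]

theorem monotone_boundedBy_cons (s : List ℕ) : Monotone fun k ↦ boundedBy (k :: s) :=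
  fun _ _ hkl _ hσ ↦
    have h := mem_boundedBy_cons.1 hσ
    mem_boundedBy_cons.2 ⟨h.1.trans hkl, h.2⟩

theorem iUnion_boundedBy_cons (s : List ℕ) : ⋃ k, boundedBy (k :: s) = boundedBy s := by
  ext σ
  simp only [mem_iUnion, mem_boundedBy_cons]
  exact ⟨fun ⟨_, _, h⟩ ↦ h, fun h ↦ ⟨_, le_rfl, h⟩⟩

theorem mem_boundedBy_res {τ σ : ℕ → ℕ} {n : ℕ} :
    σ ∈ boundedBy (PiNat.res τ n) ↔ ∀ i < n, σ i ≤ τ i := by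
  induction n with
  | zero => simp [boundedBy]
  | succ n ih =>
    rw [PiNat.res_succ, mem_boundedBy_cons, PiNat.res_length, ih, Nat.forall_lt_succ_right,
      and_comm]

theorem antitone_boundedBy_res (τ : ℕ → ℕ) : Antitone fun n ↦ boundedBy (PiNat.res τ n) :=
  fun _ _ hnm _ hσ ↦ mem_boundedBy_res.2 fun i hi ↦ mem_boundedBy_res.1 hσ i (hi.trans_le hnm)

theorem isOpen_setOf_res_eq (n : ℕ) (s : List ℕ) : IsOpen {τ : ℕ → ℕ | PiNat.res τ n = s} := by
  rcases {τ : ℕ → ℕ | PiNat.res τ n = s}.eq_empty_or_nonempty with h | ⟨τ, rfl⟩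
  · exact h ▸ isOpen_empty
  · exact PiNat.cylinder_eq_res τ n ▸ PiNat.isOpen_cylinder _ τ n

theorem exists_seq_eq_apply_res (k : List ℕ → ℕ) : ∃ τ : ℕ → ℕ, ∀ n, τ n = k (PiNat.res τ n) := by
  let p (n : ℕ) : List ℕ := n.rec [] fun _ s ↦ k s :: s
  have hp (n : ℕ) : PiNat.res (fun n ↦ k (p n)) n = p n := by
    induction n with
    | zero => rfl
    | succ n ih => rw [PiNat.res_succ, ih]
  exact ⟨fun n ↦ k (p n), fun n ↦ by rw [hp]⟩

theorem measurable_apply_res {X Y : Type*} [MeasurableSpace X] [MeasurableSpace Y]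
    {f : List ℕ → X → Y} (hf : ∀ s, Measurable (f s)) {σ : X → ℕ → ℕ} {n : ℕ}
    (hσ : ∀ i < n, Measurable fun x ↦ σ x i) : Measurable fun x ↦ f (PiNat.res (σ x) n) x := by
  induction n generalizing f with
  | zero => exact hf []
  | succ n ih =>
    have hcons (s : List ℕ) : Measurable fun x ↦ f (σ x n :: s) x :=
      (measurable_from_prod_countable_right (f := fun p : ℕ × X ↦ f (p.1 :: s) p.2)
        fun k ↦ hf (k :: s)).comp ((hσ n n.lt_succ_self).prodMk measurable_id)
    exact ih hcons fun i hi ↦ hσ i (hi.trans n.lt_succ_self)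

theorem exists_boundedBy_res_subset {W : Set (ℕ → ℕ)} (hW : IsOpen W) {τ : ℕ → ℕ}
    (hτ : Iic τ ⊆ W) : ∃ n, boundedBy (PiNat.res τ n) ⊆ W := by
  let := PiNat.metricSpaceNatNat
  have hcompact : IsCompact (Iic τ) := Icc_bot (a := τ) ▸ isCompact_Icc
  obtain ⟨δ, hδ, hδW⟩ := hcompact.exists_thickening_subset_open hW hτ
  obtain ⟨n, hn⟩ := exists_pow_lt_of_lt_one hδ one_half_lt_one
  refine ⟨n, fun σ hσ ↦ hδW (Metric.mem_thickening_iff.2 ⟨σ ⊓ τ, mem_Iic.2 inf_le_right, ?_⟩)⟩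
  refine (PiNat.mem_cylinder_iff_dist_le.1 fun i hi ↦ ?_).trans_lt hn
  simpa using mem_boundedBy_res.1 hσ i hi

theorem iInter_closure_image_boundedBy_subset {Z : Type*} [TopologicalSpace Z] [T2Space Z]
    {f : (ℕ → ℕ) → Z} (hf : Continuous f) (τ : ℕ → ℕ) :
    ⋂ n, closure (f '' boundedBy (PiNat.res τ n)) ⊆ f '' Iic τ := by
  intro y hy
  by_contra hyτ
  have hcompact : IsCompact (Iic τ) := Icc_bot (a := τ) ▸ isCompact_Icc
  obtain ⟨U, V, hU, hV, hτU, hyV, hUV⟩ := SeparatedNhds.of_isCompact_isCompact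
    (hcompact.image hf) isCompact_singleton (disjoint_singleton_right.2 hyτ)
  obtain ⟨n, hn⟩ := exists_boundedBy_res_subset (hU.preimage hf) (image_subset_iff.1 hτU)
  exact (hUV.closure_left hV).notMem_of_mem_left
    (closure_mono (image_subset_iff.2 hn) (mem_iInter.1 hy n)) (hyV rfl)

end BaireSpace

section Capacitability

variable {Z : Type*} [MeasurableSpace Z]

theorem exists_lt_measure_image_boundedBy (μ : Measure Z) (f : (ℕ → ℕ) → Z) {c : ℝ≥0∞}
    (hc : c < μ (range f)) : ∃ τ : ℕ → ℕ, ∀ n, c < μ (f '' boundedBy (PiNat.res τ n)) := by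
  have hcons (s : List ℕ) (hs : c < μ (f '' boundedBy s)) :
      ∃ k, c < μ (f '' boundedBy (k :: s)) := by
    have hmono : Monotone fun k ↦ f '' boundedBy (k :: s) :=
      fun _ _ hkl ↦ image_mono (monotone_boundedBy_cons s hkl)
    rwa [← iUnion_boundedBy_cons, image_iUnion, hmono.measure_iUnion, lt_iSup_iff] at hs
  choose! k hk using hcons
  obtain ⟨τ, hτ⟩ := exists_seq_eq_apply_res k
  refine ⟨τ, fun n ↦ ?_⟩
  induction n with
  | zero => simpa [boundedBy_nil] using hc
  | succ n ih =>
    rw [PiNat.res_succ, hτ n]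
    exact hk _ ih

variable [TopologicalSpace Z] [OpensMeasurableSpace Z]

theorem le_measure_iInter_closure_image_boundedBy {μ : Measure Z} [IsFiniteMeasure μ]
    {f : (ℕ → ℕ) → Z} {τ : ℕ → ℕ} {c : ℝ≥0∞}
    (h : ∀ n, c ≤ μ (closure (f '' boundedBy (PiNat.res τ n)))) :
    c ≤ μ (⋂ n, closure (f '' boundedBy (PiNat.res τ n))) := by
  rw [Antitone.measure_iInter
    (fun n m hnm ↦ closure_mono (image_mono (antitone_boundedBy_res τ hnm)))
    (fun n ↦ isClosed_closure.measurableSet.nullMeasurableSet) ⟨0, measure_ne_top _ _⟩]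
  exact le_iInf h

variable [T2Space Z] {A : Set Z}

theorem exists_isClosed_subset_le_measure_of_analyticSet (hA : AnalyticSet A) (μ : Measure Z)
    [IsFiniteMeasure μ] {c : ℝ≥0∞} (hc : c < μ A) : ∃ C ⊆ A, IsClosed C ∧ c ≤ μ C := by
  obtain ⟨f, hf, rfl⟩ :=
    exists_continuous_range_eq_of_analyticSet hA (nonempty_of_measure_ne_zero hc.ne_bot)
  obtain ⟨τ, hτ⟩ := exists_lt_measure_image_boundedBy μ f hc
  exact ⟨_, (iInter_closure_image_boundedBy_subset hf τ).trans (image_subset_range _ _),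
    isClosed_iInter fun _ ↦ isClosed_closure, le_measure_iInter_closure_image_boundedBy
      fun n ↦ (hτ n).le.trans (measure_mono subset_closure)⟩

theorem nullMeasurableSet_of_analyticSet (hA : AnalyticSet A) (μ : Measure Z) [SFinite μ] :
    NullMeasurableSet A μ := by
  wlog hμ : IsFiniteMeasure μ
  · exact (this hA μ.toFinite inferInstance).mono_ac (absolutelyContinuous_toFinite μ)
  obtain hA0 | hA0 := eq_or_ne (μ A) 0
  · exact NullMeasurableSet.of_null hA0
  obtain ⟨u, -, hu, hlim⟩ := exists_seq_strictMono_tendsto' hA0.bot_lt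
  choose C hCA hC hle using fun n ↦
    exists_isClosed_subset_le_measure_of_analyticSet hA μ (hu n).2
  have hU : NullMeasurableSet (⋃ n, C n) μ :=
    (MeasurableSet.iUnion fun n ↦ (hC n).measurableSet).nullMeasurableSet
  have hge : μ A ≤ μ (⋃ n, C n) :=
    le_of_tendsto' hlim fun n ↦ (hle n).trans (measure_mono (subset_iUnion C n))
  exact hU.congr (ae_eq_of_subset_of_measure_ge (iUnion_subset hCA) hge hU (measure_ne_top _ _))

variable {T : Type*} [MeasurableSpace T] [StandardBorelSpace T] [TopologicalSpace T]
  [SecondCountableTopology T] [OpensMeasurableSpace T]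

theorem analyticSet_lt_kernel_of_isFiniteKernel (hA : AnalyticSet A) (κ : Kernel T Z)
    [IsFiniteKernel κ] (c : ℝ≥0∞) : AnalyticSet {t | c < κ t A} := by
  rcases A.eq_empty_or_nonempty with rfl | hne
  · simpa using analyticSet_empty
  obtain ⟨f, hf, rfl⟩ := exists_continuous_range_eq_of_analyticSet hA hne
  let F (s : List ℕ) : Set Z := closure (f '' boundedBy s)
  have hF (s : List ℕ) : Measurable fun t ↦ κ t (F s) :=
    κ.measurable_coe isClosed_closure.measurableSet
  let G (q : ℚ) : Set (T × (ℕ → ℕ)) := {p | ∀ n, ENNReal.ofReal q ≤ κ p.1 (F (PiNat.res p.2 n))}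
  have hG (q : ℚ) : MeasurableSet (G q) := by
    simp only [G, ofPred_forall]
    exact MeasurableSet.iInter fun n ↦ measurableSet_le measurable_const <|
      measurable_apply_res (fun s ↦ (hF s).comp measurable_fst)
        fun i _ ↦ (measurable_pi_apply i).comp measurable_snd
  have hU : {t | c < κ t (range f)} =
      ⋃ q : {q : ℚ // c < ENNReal.ofReal q}, Prod.fst '' G q := by
    ext t
    simp only [G, mem_ofPred_eq, mem_iUnion, mem_image, Prod.exists, exists_and_right,
      exists_eq_right]
    constructor
    · intro hc
      obtain ⟨q, -, hcq, hq⟩ := ENNReal.lt_iff_exists_rat_btwn.1 hc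
      obtain ⟨τ, hτ⟩ := exists_lt_measure_image_boundedBy (κ t) f hq
      exact ⟨⟨q, hcq⟩, τ, fun n ↦ (hτ n).le.trans (measure_mono subset_closure)⟩
    · rintro ⟨⟨q, hcq⟩, τ, hτ⟩
      exact hcq.trans_le ((le_measure_iInter_closure_image_boundedBy hτ).trans (measure_mono
        ((iInter_closure_image_boundedBy_subset hf τ).trans (image_subset_range _ _))))
  rw [hU]
  exact AnalyticSet.iUnion fun q ↦ (hG q).analyticSet_image measurable_fst

theorem analyticSet_lt_kernel (hA : AnalyticSet A) (κ : Kernel T Z) [IsSFiniteKernel κ]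
    (c : ℝ≥0∞) : AnalyticSet {t | c < κ t A} := by
  have hU : {t | c < κ t A} = ⋃ n, {t | c < (∑ i ∈ Finset.range n, κ.seq i) t A} := by
    ext t
    rw [mem_ofPred_eq, ← κ.measure_sum_seq t, Measure.sum_apply_of_countable,
      ENNReal.tsum_eq_iSup_nat, lt_iSup_iff]
    simp only [mem_iUnion, mem_ofPred_eq, Kernel.finsetSum_apply']
  have hfinite (n : ℕ) : IsFiniteKernel (∑ i ∈ Finset.range n, κ.seq i) :=
    Finset.sum_induction _ IsFiniteKernel (fun _ _ _ _ ↦ inferInstance) inferInstance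
      fun _ _ ↦ inferInstance
  rw [hU]
  exact AnalyticSet.iUnion fun n ↦ analyticSet_lt_kernel_of_isFiniteKernel hA _ c

end Capacitability

section Selection

theorem exists_measurable_index {X : Type*} [MeasurableSpace X] {D : ℕ → Set X}
    (hD : ∀ k, MeasurableSet (D k)) :
    ∃ k : X → ℕ, Measurable k ∧ ∀ x ∈ ⋃ j, D j, x ∈ D (k x) := by
  classical
  have hex (x : X) : ∃ j, x ∈ D j ∨ x ∉ ⋃ j, D j := by
    by_cases hx : x ∈ ⋃ j, D j
    · exact (mem_iUnion.1 hx).imp fun _ ↦ Or.inl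
    · exact ⟨0, Or.inr hx⟩
  exact ⟨fun x ↦ Nat.find (hex x),
    measurable_find hex fun j ↦ (hD j).union (MeasurableSet.iUnion hD).compl,
    fun x hx ↦ (Nat.find_spec (hex x)).resolve_right (not_not.2 hx)⟩

variable {X : Type*} [TopologicalSpace X]

theorem measurableSet_analyticSigma {s : Set X} (hs : AnalyticSet s) :
    MeasurableSet[analyticSigma X] s :=
  MeasurableSpace.measurableSet_generateFrom hs

theorem eq_of_forall_mem_image_res [T1Space X] {g : (ℕ → ℕ) → X} (hg : Continuous g) {σ : ℕ → ℕ}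
    {x : X} (h : ∀ n, x ∈ g '' {τ | PiNat.res τ n = PiNat.res σ n}) : g σ = x := by
  choose τ hτ hx using h
  have hlim : Tendsto τ atTop (𝓝 σ) := tendsto_pi_nhds.2 fun i ↦
    tendsto_atTop_of_eventually_const (i₀ := i + 1) fun n hn ↦ PiNat.res_eq_res.1 (hτ n) hn
  have hconst := (hg.tendsto σ).comp hlim
  simp only [Function.comp_def, hx] at hconst
  exact (tendsto_const_nhds_iff.1 hconst).symm

theorem exists_measurable_rightInverse [T1Space X] {g : (ℕ → ℕ) → X} (hg : Continuous g) :
    ∃ σ : X → ℕ → ℕ, Measurable[analyticSigma X] σ ∧ ∀ x ∈ range g, g (σ x) = x := by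
  let := analyticSigma X
  let D (s : List ℕ) : Set X := g '' {τ | PiNat.res τ s.length = s}
  have hD (s : List ℕ) : MeasurableSet (D s) :=
    measurableSet_analyticSigma ((isOpen_setOf_res_eq s.length s).analyticSet_image hg)
  choose k hk hkD using fun s ↦ exists_measurable_index fun j ↦ hD (j :: s)
  choose σ hσ using fun x ↦ exists_seq_eq_apply_res fun s ↦ k s x
  refine ⟨σ, measurable_pi_iff.2 fun n ↦ ?_, fun x hx ↦ eq_of_forall_mem_image_res hg fun n ↦ ?_⟩
  · induction n using Nat.strong_induction_on with
    | _ n ih => simpa only [hσ _ n] using measurable_apply_res hk ih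
  · suffices x ∈ D (PiNat.res (σ x) n) by simpa only [D, PiNat.res_length] using this
    induction n with
    | zero => simpa [D] using hx
    | succ n ih =>
      obtain ⟨τ, hτ, hτx⟩ := ih
      rw [PiNat.res_succ, hσ x n]
      rw [mem_ofPred_eq, PiNat.res_length] at hτ
      refine hkD _ x (mem_iUnion.2 ⟨τ n, τ, ?_, hτx⟩)
      simp [hτ]

theorem exists_measurable_selection [T1Space X] {Y : Type*} [TopologicalSpace Y]
    [MeasurableSpace Y] [BorelSpace Y] [Nonempty Y] {A : Set (X × Y)} (hA : AnalyticSet A) :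
    ∃ s : X → Y, Measurable[analyticSigma X] s ∧ ∀ x ∈ Prod.fst '' A, (x, s x) ∈ A := by
  rcases A.eq_empty_or_nonempty with rfl | hne
  · exact ⟨fun _ ↦ Classical.arbitrary Y, measurable_const, by simp⟩
  obtain ⟨f, hf, rfl⟩ := exists_continuous_range_eq_of_analyticSet hA hne
  obtain ⟨σ, hσ, hfσ⟩ := exists_measurable_rightInverse (continuous_fst.comp hf)
  refine ⟨fun x ↦ (f (σ x)).2, (continuous_snd.comp hf).measurable.comp hσ, fun x hx ↦ ?_⟩
  rw [← range_comp] at hx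
  exact ⟨σ x, Prod.ext (hfσ x hx) rfl⟩

theorem aemeasurable_of_measurable_analyticSigma [MeasurableSpace X] [OpensMeasurableSpace X]
    [T2Space X] {Y : Type*} [MeasurableSpace Y] [MeasurableSpace.CountablyGenerated Y] {f : X → Y}
    (hf : Measurable[analyticSigma X] f) (μ : Measure X) [SFinite μ] : AEMeasurable f μ :=
  have hle : analyticSigma X ≤ (inferInstance : MeasurableSpace (NullMeasurableSpace X μ)) :=
    MeasurableSpace.generateFrom_le fun _ hs ↦ nullMeasurableSet_of_analyticSet hs μ
  NullMeasurable.aemeasurable fun _ hs ↦ hle _ (hf hs)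

end Selection

section UpperSemianalytic

variable {X : Type*} [TopologicalSpace X] {Φ : X → ℝ≥0∞}

theorem upperSemianalytic_coe_ennreal_iff (hX : AnalyticSet (univ : Set X)) :
    UpperSemianalytic (fun x ↦ (Φ x : EReal)) ↔ ∀ c : ℝ≥0∞, AnalyticSet {x | c < Φ x} := by
  constructor
  · intro h c
    induction c with
    | top => simpa using analyticSet_empty
    | coe c =>
      convert h c using 3 with x
      exact EReal.coe_ennreal_lt_coe_ennreal_iff.symm
  · intro h r
    rcases le_or_gt 0 r with hr | hr
    · convert h (ENNReal.ofReal r) using 3 with x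
      rw [← EReal.coe_ennreal_lt_coe_ennreal_iff, EReal.coe_ennreal_ofReal, max_eq_left hr]
    · convert hX
      ext x
      simpa using (EReal.coe_lt_coe_iff.2 hr).trans_le (EReal.coe_ennreal_nonneg (Φ x))

variable [MeasurableSpace X] [SecondCountableTopology X] [StandardBorelSpace X]

theorem measurable_analyticSigma_of_upperSemianalytic [OpensMeasurableSpace X]
    (hΦ : UpperSemianalytic fun x ↦ (Φ x : EReal)) : Measurable[analyticSigma X] Φ := by
  rw [upperSemianalytic_coe_ennreal_iff (analyticSet_of_measurableSet .univ)] at hΦ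
  let := analyticSigma X
  exact measurable_of_Ioi fun c ↦ measurableSet_analyticSigma (hΦ c)

theorem upperSemianalytic_comp_measurable [OpensMeasurableSpace X] {Y : Type*}
    [TopologicalSpace Y] [MeasurableSpace Y] [BorelSpace Y] [MeasurableEq Y] {g : Y → EReal}
    (hg : UpperSemianalytic g) {f : X → Y} (hf : Measurable f) :
    UpperSemianalytic fun x ↦ g (f x) :=
  fun c ↦ analyticSet_preimage_of_measurable (hg c) hf

variable [T2Space X] [OpensMeasurableSpace X]

theorem analyticSet_lt_of_upperSemianalytic (hΦ : UpperSemianalytic fun x ↦ (Φ x : EReal))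
    {g : X → ℝ≥0∞} (hg : Measurable g) : AnalyticSet {x | g x < Φ x} := by
  have hU : {x | g x < Φ x} =
      ⋃ q : ℚ, {x | g x < ENNReal.ofReal q} ∩ {x | ENNReal.ofReal q < Φ x} := by
    ext x
    simp only [mem_ofPred_eq, mem_iUnion, mem_inter_iff]
    exact ⟨fun h ↦ (ENNReal.lt_iff_exists_rat_btwn.1 h).imp fun _ ↦ And.right,
      fun ⟨_, hgq, hqΦ⟩ ↦ hgq.trans hqΦ⟩
  rw [upperSemianalytic_coe_ennreal_iff (analyticSet_of_measurableSet .univ)] at hΦ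
  rw [hU]
  exact AnalyticSet.iUnion fun q ↦
    analyticSet_inter (analyticSet_of_measurableSet (hg measurableSet_Iio)) (hΦ _)

theorem aemeasurable_of_upperSemianalytic (hΦ : UpperSemianalytic fun x ↦ (Φ x : EReal))
    (μ : Measure X) [SFinite μ] : AEMeasurable Φ μ :=
  aemeasurable_of_measurable_analyticSigma (measurable_analyticSigma_of_upperSemianalytic hΦ) μ

end UpperSemianalytic

section Integral

theorem volume_restrict_Ioi_setOf_ofReal_lt (a : ℝ≥0∞) :
    volume.restrict (Ioi 0) {t : ℝ | ENNReal.ofReal t < a} = a := by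
  rw [Measure.restrict_apply (measurableSet_lt ENNReal.measurable_ofReal measurable_const)]
  induction a with
  | top => simp
  | coe a =>
    have h : {t : ℝ | ENNReal.ofReal t < a} ∩ Ioi 0 = Ioo 0 (a : ℝ) := by
      ext t
      rw [inter_comm, mem_inter_iff, mem_Ioi, mem_Ioo, and_congr_right_iff, mem_ofPred_eq]
      intro ht
      rw [← ENNReal.ofReal_coe_nnreal, ENNReal.ofReal_lt_ofReal_iff_of_nonneg ht.le]
    rw [h, Real.volume_Ioo, sub_zero, ENNReal.ofReal_coe_nnreal]

theorem measure_prod_hypograph {X : Type*} [MeasurableSpace X] {μ : Measure X} {Φ : X → ℝ≥0∞}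
    (hΦ : AEMeasurable Φ μ) :
    μ.prod (volume.restrict (Ioi 0)) {p : X × ℝ | ENNReal.ofReal p.2 < Φ p.1} =
      ∫⁻ x, Φ x ∂μ := by
  let ν : Measure ℝ := volume.restrict (Ioi 0)
  let H : Set (X × ℝ) := {p | ENNReal.ofReal p.2 < Φ p.1}
  have hH : NullMeasurableSet H (μ.prod ν) :=
    nullMeasurableSet_lt measurable_snd.ennreal_ofReal.aemeasurable hΦ.comp_fst
  have hsection (x : X) : MeasurableSet {t : ℝ | ENNReal.ofReal t < Φ x} :=
    measurableSet_lt ENNReal.measurable_ofReal measurable_const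
  calc μ.prod ν H = ∫⁻ p, H.indicator 1 p ∂μ.prod ν := (lintegral_indicator_one₀ hH).symm
    _ = ∫⁻ x, ∫⁻ t, H.indicator 1 (x, t) ∂ν ∂μ :=
      lintegral_prod _ (aemeasurable_one.indicator₀ hH)
    _ = ∫⁻ x, ν {t | ENNReal.ofReal t < Φ x} ∂μ :=
      lintegral_congr fun x ↦ lintegral_indicator_one (hsection x)
    _ = ∫⁻ x, Φ x ∂μ := lintegral_congr fun x ↦ volume_restrict_Ioi_setOf_ofReal_lt (Φ x)

variable {X : Type*} [TopologicalSpace X] [MeasurableSpace X] [SecondCountableTopology X]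
  [StandardBorelSpace X] [BorelSpace X] [T2Space X] {Φ : X → ℝ≥0∞}

theorem upperSemianalytic_lintegral_kernel {T : Type*} [TopologicalSpace T] [MeasurableSpace T]
    [SecondCountableTopology T] [StandardBorelSpace T] [OpensMeasurableSpace T]
    (hΦ : UpperSemianalytic fun x ↦ (Φ x : EReal)) (κ : Kernel T X) [IsSFiniteKernel κ] :
    UpperSemianalytic fun t ↦ ((∫⁻ x, Φ x ∂κ t : ℝ≥0∞) : EReal) := by
  have hH : AnalyticSet {p : X × ℝ | ENNReal.ofReal p.2 < Φ p.1} :=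
    analyticSet_lt_of_upperSemianalytic (upperSemianalytic_comp_measurable hΦ measurable_fst)
      measurable_snd.ennreal_ofReal
  rw [upperSemianalytic_coe_ennreal_iff (analyticSet_of_measurableSet .univ)]
  intro c
  convert analyticSet_lt_kernel hH (κ ×ₖ Kernel.const T (volume.restrict (Ioi 0))) c with t
  rw [Kernel.prod_apply, Kernel.const_apply,
    measure_prod_hypograph (aemeasurable_of_upperSemianalytic hΦ _)]

/-- The kernel sending a probability measure to itself, through which facts on kernels apply to
the evaluation `μ ↦ ∫ f dμ`. -/
noncomputable def evalKernel (X : Type*) [MeasurableSpace X] : Kernel (ProbabilityMeasure X) X :=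
  ⟨fun μ ↦ μ, measurable_subtype_coe⟩

instance (X : Type*) [MeasurableSpace X] : IsMarkovKernel (evalKernel X) :=
  ⟨fun μ ↦ μ.2⟩

end Integral

section Admissible

variable {E : Type*} [TopologicalSpace E] [MeasurableSpace E] {J : Set (E × ProbabilityMeasure E)}
  {κ : E → ProbabilityMeasure E}

theorem isAdmissible_iff_measurable_forall_mem :
    IsAdmissible J κ ↔ Measurable[analyticSigma E] κ ∧ ∀ x, (x, κ x) ∈ J := by
  refine ⟨fun h ↦ ⟨?_, h.mem⟩, fun h ↦ ⟨fun B hB ↦ (measurable_measure_coe hB).comp h.1, h.2⟩⟩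
  have hκ : Measurable[analyticSigma E] fun x ↦ (κ x : Measure E) :=
    @Measure.measurable_of_measurable_coe _ _ _ (analyticSigma E) _ h.measurable
  exact hκ.subtype_mk

theorem IsAdmissible.measurable_analyticSigma (h : IsAdmissible J κ) :
    Measurable[analyticSigma E] κ :=
  (isAdmissible_iff_measurable_forall_mem.1 h).1

theorem IsAdmissible.piecewise (h : IsAdmissible J κ) {S : Set E} [DecidablePred (· ∈ S)]
    (hS : MeasurableSet[analyticSigma E] S) {s : E → ProbabilityMeasure E}
    (hs : Measurable[analyticSigma E] s) (hsJ : ∀ x ∈ S, (x, s x) ∈ J) :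
    IsAdmissible J (S.piecewise s κ) := by
  refine isAdmissible_iff_measurable_forall_mem.2 ⟨?_, fun x ↦ ?_⟩
  · have hκ := h.measurable_analyticSigma
    let := analyticSigma E
    exact hs.piecewise hS hκ
  · by_cases hx : x ∈ S
    · simpa [hx] using hsJ x hx
    · simpa [hx] using h.mem x

variable [OpensMeasurableSpace E] [T2Space E] [StandardBorelSpace E]

theorem IsAdmissible.aemeasurable (h : IsAdmissible J κ) (μ : Measure E) [SFinite μ] :
    AEMeasurable (fun x ↦ (κ x : Measure E)) μ :=
  measurable_subtype_coe.comp_aemeasurable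
    (aemeasurable_of_measurable_analyticSigma h.measurable_analyticSigma μ)

theorem IsAdmissible.isComposition_iff (h : IsAdmissible J κ) {m ν : ProbabilityMeasure E} :
    IsComposition m κ ν ↔ (ν : Measure E) = (m : Measure E).bind fun x ↦ (κ x : Measure E) := by
  have hbind (B : Set E) (hB : MeasurableSet B) :
      (m : Measure E).bind (fun x ↦ (κ x : Measure E)) B =
        pairing m fun x ↦ (κ x : Measure E) B :=
    Measure.bind_apply hB (h.aemeasurable _)
  exact ⟨fun hν ↦ Measure.ext fun B hB ↦ (hν B hB).trans (hbind B hB).symm,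
    fun hν B hB ↦ hν ▸ hbind B hB⟩

theorem IsAdmissible.exists_isComposition (h : IsAdmissible J κ) (m : ProbabilityMeasure E) :
    ∃ ν, IsComposition m κ ν :=
  ⟨⟨_, isProbabilityMeasure_bind (h.aemeasurable m) (ae_of_all _ fun _ ↦ inferInstance)⟩,
    h.isComposition_iff.2 rfl⟩

theorem IsAdmissible.pairing_of_isComposition [SecondCountableTopology E] (h : IsAdmissible J κ)
    {m ν : ProbabilityMeasure E} (hν : IsComposition m κ ν) {Φ : E → ℝ≥0∞}
    (hΦ : UpperSemianalytic fun x ↦ (Φ x : EReal)) :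
    pairing ν Φ = pairing m fun x ↦ pairing (κ x) Φ := by
  have hbind := h.isComposition_iff.1 hν
  have hΦν := aemeasurable_of_upperSemianalytic hΦ (ν : Measure E)
  rw [hbind] at hΦν
  rw [pairing, hbind]
  exact Measure.lintegral_bind (h.aemeasurable _) hΦν

end Admissible

section Gain

theorem image_fst_inter_lt_pairing {E : Type*} [MeasurableSpace E]
    (J : Set (E × ProbabilityMeasure E)) (Φ g : E → ℝ≥0∞) :
    Prod.fst '' (J ∩ {p | g p.1 < pairing p.2 Φ}) = {x | g x < gain J Φ x} := by
  ext x
  simp [gain, supPairing, lt_iSup_iff]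

variable {E : Type*} [TopologicalSpace E] [MeasurableSpace E] [BorelSpace E]
  [SecondCountableTopology E] [MetrizableSpace E] {J K : Set (E × ProbabilityMeasure E)}

theorem IsHouse.exists_isAdmissible (hJ : IsHouse J) : ∃ κ, IsAdmissible J κ := by
  cases isEmpty_or_nonempty E
  · exact ⟨isEmptyElim, isAdmissible_iff_measurable_forall_mem.2
      ⟨@measurable_of_empty _ _ (analyticSigma E) _ _ _, isEmptyElim⟩⟩
  · have : Nonempty (ProbabilityMeasure E) :=
      (hJ.nonempty_section (Classical.arbitrary E)).nonempty
    obtain ⟨s, hs, hsJ⟩ := exists_measurable_selection hJ.analytic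
    refine ⟨s, isAdmissible_iff_measurable_forall_mem.2 ⟨hs, fun x ↦ hsJ x ?_⟩⟩
    exact (hJ.nonempty_section x).imp' _ fun μ hμ ↦ ⟨hμ, rfl⟩

variable [StandardBorelSpace E] {Φ : E → ℝ≥0∞}

theorem upperSemianalytic_pairing (hΦ : UpperSemianalytic fun x ↦ (Φ x : EReal)) :
    UpperSemianalytic fun μ : ProbabilityMeasure E ↦ (pairing μ Φ : EReal) :=
  upperSemianalytic_lintegral_kernel hΦ (evalKernel E)

theorem analyticSet_inter_lt_pairing (hJ : AnalyticSet J)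
    (hΦ : UpperSemianalytic fun x ↦ (Φ x : EReal)) {g : E → ℝ≥0∞} (hg : Measurable g) :
    AnalyticSet (J ∩ {p | g p.1 < pairing p.2 Φ}) :=
  analyticSet_inter hJ <| analyticSet_lt_of_upperSemianalytic
    (upperSemianalytic_comp_measurable (upperSemianalytic_pairing hΦ) measurable_snd)
    (hg.comp measurable_fst)

theorem upperSemianalytic_gain (hJ : AnalyticSet J)
    (hΦ : UpperSemianalytic fun x ↦ (Φ x : EReal)) :
    UpperSemianalytic fun x ↦ (gain J Φ x : EReal) := by
  rw [upperSemianalytic_coe_ennreal_iff (analyticSet_of_measurableSet .univ)]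
  intro c
  rw [← image_fst_inter_lt_pairing J Φ fun _ ↦ c]
  exact (analyticSet_inter_lt_pairing hJ hΦ measurable_const).image_of_continuous continuous_fst

theorem IsHouse.exists_isAdmissible_lt_pairing (hJ : IsHouse J)
    (hΦ : UpperSemianalytic fun x ↦ (Φ x : EReal)) {g : E → ℝ≥0∞} (hg : Measurable g) :
    ∃ κ, IsAdmissible J κ ∧ ∀ x, g x < gain J Φ x → g x < pairing (κ x) Φ := by
  classical
  obtain ⟨κ, hκ⟩ := hJ.exists_isAdmissible
  cases isEmpty_or_nonempty E
  · exact ⟨κ, hκ, isEmptyElim⟩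
  have : Nonempty (ProbabilityMeasure E) := ⟨κ (Classical.arbitrary E)⟩
  have hA := analyticSet_inter_lt_pairing hJ.analytic hΦ hg
  obtain ⟨s, hs, hsA⟩ := exists_measurable_selection hA
  have hS := measurableSet_analyticSigma (hA.image_of_continuous continuous_fst)
  rw [image_fst_inter_lt_pairing] at hsA hS
  refine ⟨_, hκ.piecewise hS hs fun x hx ↦ (hsA x hx).1, fun x hx ↦ ?_⟩
  rw [piecewise_eq_of_mem {x | g x < gain J Φ x} _ _ hx]
  exact (hsA x hx).2

theorem IsHouse.exists_isAdmissible_le_pairing_add (hJ : IsHouse J)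
    (hΦ : UpperSemianalytic fun x ↦ (Φ x : EReal)) {φ : E → NNReal} (hφ : Measurable φ)
    (hφJ : ∀ x, φ x ≤ gain J Φ x) {ε : NNReal} (hε : 0 < ε) :
    ∃ κ, IsAdmissible J κ ∧ ∀ x, (φ x : ℝ≥0∞) ≤ pairing (κ x) Φ + ε := by
  obtain ⟨κ, hκ, hlt⟩ :=
    hJ.exists_isAdmissible_lt_pairing hΦ (hφ.coe_nnreal_ennreal.sub_const (ε : ℝ≥0∞))
  refine ⟨κ, hκ, fun x ↦ ?_⟩
  obtain hx | hx := eq_or_ne (φ x) 0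
  · simp [hx]
  have hsub : (φ x - ε : ℝ≥0∞) < φ x :=
    ENNReal.sub_lt_self ENNReal.coe_ne_top (ENNReal.coe_ne_zero.2 hx) (ENNReal.coe_ne_zero.2 hε.ne')
  exact tsub_le_iff_right.1 (hlt x (hsub.trans_le (hφJ x))).le

theorem IsHouse.supPairing_measureComp (hJ : IsHouse J)
    (hΦ : UpperSemianalytic fun x ↦ (Φ x : EReal)) (m : ProbabilityMeasure E) :
    supPairing (measureComp m J) Φ = pairing m (gain J Φ) := by
  apply le_antisymm
  · refine iSup₂_le fun ν ⟨κ, hκ, hν⟩ ↦ ?_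
    rw [hκ.pairing_of_isComposition hν hΦ]
    exact lintegral_mono fun x ↦ le_iSup₂_of_le (κ x) (hκ.mem x) le_rfl
  · rw [pairing, lintegral_eq_nnreal]
    refine iSup₂_le fun φ hφ ↦ ENNReal.le_of_forall_pos_le_add fun ε hε _ ↦ ?_
    obtain ⟨κ, hκ, hle⟩ := hJ.exists_isAdmissible_le_pairing_add hΦ φ.measurable hφ hε
    obtain ⟨ν, hν⟩ := hκ.exists_isComposition m
    calc (φ.map ((↑) : NNReal → ℝ≥0∞)).lintegral m = ∫⁻ x, φ x ∂(m : Measure E) :=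
          (SimpleFunc.lintegral_eq_lintegral _ _).symm
      _ ≤ ∫⁻ x, pairing (κ x) Φ + ε ∂(m : Measure E) := lintegral_mono hle
      _ = pairing ν Φ + ε := by
          rw [lintegral_add_right _ measurable_const, hκ.pairing_of_isComposition hν hΦ]
          simp [pairing]
      _ ≤ supPairing (measureComp m J) Φ + ε := by
          gcongr
          exact le_iSup₂_of_le ν ⟨κ, hκ, hν⟩ le_rfl

theorem IsHouse.gain_houseComp (hK : IsHouse K) (hΦ : UpperSemianalytic fun x ↦ (Φ x : EReal)) :
    gain (houseComp J K) Φ = gain J (gain K Φ) := by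
  ext x
  calc gain (houseComp J K) Φ x = ⨆ μ ∈ {μ | (x, μ) ∈ J}, supPairing (measureComp μ K) Φ := by
        simp only [gain, supPairing, houseComp, mem_ofPred_eq, iSup_exists, iSup_and]
        rw [iSup_comm]
        exact iSup_congr fun μ ↦ iSup_comm
    _ = gain J (gain K Φ) x :=
      iSup_congr fun μ ↦ iSup_congr fun _ ↦ hK.supPairing_measureComp hΦ μ

end Gain

section Disintegration

variable {X Y : Type*} [MeasurableSpace X] [MeasurableSpace Y]
  [MeasurableSpace.CountablyGenerated X] [StandardBorelSpace Y] [Nonempty Y]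

/-- The conditional law of the second coordinate given that the first one is `x`, under the law
`γ` on `X × Y`, as a function of the pair `(γ, x)`. Unlike `(γ : Measure (X × Y)).condKernel`, which
is chosen separately for every `γ`, it is jointly measurable in `γ` and `x`. -/
noncomputable def condLaw (p : ProbabilityMeasure (X × Y) × X) : ProbabilityMeasure Y :=
  ⟨(evalKernel (X × Y)).condKernel p, inferInstance⟩

theorem measurable_condLaw : Measurable (condLaw : ProbabilityMeasure (X × Y) × X → _) :=
  (evalKernel (X × Y)).condKernel.measurable.subtype_mk

theorem condLaw_ae_eq (γ : ProbabilityMeasure (X × Y)) :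
    (fun x ↦ (condLaw (γ, x) : Measure Y)) =ᵐ[(γ : Measure (X × Y)).fst]
      (γ : Measure (X × Y)).condKernel := by
  have h := Kernel.condKernel_apply_eq_condKernel (evalKernel (X × Y)) γ
  rwa [Kernel.fst_apply] at h

theorem bind_fst_condLaw (γ : ProbabilityMeasure (X × Y)) :
    ((γ : Measure (X × Y)).fst.bind fun x ↦ (condLaw (γ, x) : Measure Y)) =
      (γ : Measure (X × Y)).snd := by
  conv_rhs => rw [← (γ : Measure (X × Y)).disintegrate (γ : Measure (X × Y)).condKernel,
    Measure.snd_compProd]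
  exact Measure.bind_congr_right (condLaw_ae_eq γ)

theorem condLaw_compProd_ae_eq (μ : ProbabilityMeasure X) (η : Kernel X Y) [IsMarkovKernel η] :
    (fun x ↦ (condLaw (⟨(μ : Measure X) ⊗ₘ η, inferInstance⟩, x) : Measure Y)) =ᵐ[(μ : Measure X)]
      η := by
  have h := condLaw_ae_eq ⟨(μ : Measure X) ⊗ₘ η, inferInstance⟩
  simp only [ProbabilityMeasure.coe_mk, Measure.fst_compProd] at h
  exact h.trans (condKernel_compProd (μ : Measure X) η)

end Disintegration

section AlmostSurely

variable {T Z : Type*} [TopologicalSpace T] [MeasurableSpace T] [TopologicalSpace Z]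
  [MeasurableSpace Z] [BorelSpace Z] [SecondCountableTopology Z] [T2Space Z] [BorelSpace T]
  [T2Space T]

theorem kernel_id_prod_apply_of_analyticSet {N : Set (T × Z)} (hN : AnalyticSet N)
    (κ : Kernel T Z) [IsMarkovKernel κ] (t : T) :
    (Kernel.id ×ₖ κ) t N = κ t (Prod.mk t ⁻¹' N) := by
  have hnull := nullMeasurableSet_of_analyticSet hN ((Kernel.id ×ₖ κ) t)
  rw [Kernel.prod_apply, Kernel.id_apply, Measure.dirac_prod] at hnull ⊢
  exact Measure.map_apply₀ measurable_prodMk_left.aemeasurable hnull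

variable [SecondCountableTopology T] [StandardBorelSpace T] [StandardBorelSpace Z]

theorem analyticSet_ae_mem {N : Set (T × Z)} (hN : AnalyticSet N) (κ : Kernel T Z)
    [IsMarkovKernel κ] : AnalyticSet {t | ∀ᵐ z ∂κ t, (t, z) ∈ N} := by
  have hU : {t | ∀ᵐ z ∂κ t, (t, z) ∈ N} =
      ⋂ q : {q : ℚ // ENNReal.ofReal q < 1}, {t | ENNReal.ofReal q < (Kernel.id ×ₖ κ) t N} := by
    ext t
    have hnull : NullMeasurableSet (Prod.mk t ⁻¹' N) (κ t) :=
      nullMeasurableSet_of_analyticSet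
        (analyticSet_preimage_of_measurable hN measurable_prodMk_left) _
    have hae : (∀ᵐ z ∂κ t, (t, z) ∈ N) ↔ κ t (Prod.mk t ⁻¹' N) = 1 :=
      prob_compl_eq_zero_iff₀ hnull
    simp only [mem_iInter, mem_ofPred_eq, hae, kernel_id_prod_apply_of_analyticSet hN]
    refine ⟨fun h q ↦ q.2.trans_eq h.symm,
      fun h ↦ prob_le_one.antisymm (le_of_forall_lt fun c hc ↦ ?_)⟩
    obtain ⟨q, -, hcq, hq⟩ := ENNReal.lt_iff_exists_rat_btwn.1 hc
    exact hcq.trans (h ⟨q, hq⟩)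
  have : Nonempty {q : ℚ // ENNReal.ofReal q < 1} := ⟨0, by simp⟩
  rw [hU]
  exact AnalyticSet.iInter fun q ↦ analyticSet_lt_kernel hN _ _

end AlmostSurely

section Composition

theorem borel_le_analyticSigma {E : Type*} [TopologicalSpace E] [MeasurableSpace E]
    [OpensMeasurableSpace E] [SecondCountableTopology E] [StandardBorelSpace E] :
    (inferInstance : MeasurableSpace E) ≤ analyticSigma E :=
  fun _ hs ↦ measurableSet_analyticSigma (analyticSet_of_measurableSet hs)

variable {E : Type*} [TopologicalSpace E] [MeasurableSpace E] [BorelSpace E]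
  [SecondCountableTopology E] [MetrizableSpace E] [StandardBorelSpace E]
  {J K : Set (E × ProbabilityMeasure E)} {μ ν : ProbabilityMeasure E}

theorem exists_law_of_mem_measureComp [Nonempty E] (hν : ν ∈ measureComp μ K) :
    ∃ γ : ProbabilityMeasure (E × E), (γ : Measure (E × E)).fst = μ ∧
      (γ : Measure (E × E)).snd = ν ∧ ∀ᵐ y ∂(μ : Measure E), (y, condLaw (γ, y)) ∈ K := by
  obtain ⟨κ, hκ, hν⟩ := hν
  obtain ⟨κ', hκ', hae⟩ :=
    aemeasurable_of_measurable_analyticSigma hκ.measurable_analyticSigma (μ : Measure E)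
  let η : Kernel E E := (evalKernel E).comap κ' hκ'
  refine ⟨⟨(μ : Measure E) ⊗ₘ η, inferInstance⟩, Measure.fst_compProd _ _, ?_, ?_⟩
  · rw [hκ.isComposition_iff.1 hν]
    refine (Measure.snd_compProd _ _).trans (Measure.bind_congr_right ?_)
    exact hae.mono fun y hy ↦ congrArg Subtype.val hy.symm
  · filter_upwards [hae, condLaw_compProd_ae_eq μ η] with y hy hlaw
    have hκy : condLaw (⟨(μ : Measure E) ⊗ₘ η, inferInstance⟩, y) = κ y :=
      (Subtype.ext hlaw).trans hy.symm
    exact hκy ▸ hκ.mem y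

theorem mem_measureComp_of_law [Nonempty E] (hK : IsHouse K) {γ : ProbabilityMeasure (E × E)}
    (hfst : (γ : Measure (E × E)).fst = μ) (hsnd : (γ : Measure (E × E)).snd = ν)
    (hae : ∀ᵐ y ∂(μ : Measure E), (y, condLaw (γ, y)) ∈ K) : ν ∈ measureComp μ K := by
  classical
  obtain ⟨κ, hκ⟩ := hK.exists_isAdmissible
  have hlaw : Measurable fun y ↦ condLaw (γ, y) := measurable_condLaw.comp measurable_prodMk_left
  have hS : AnalyticSet {y | (y, condLaw (γ, y)) ∈ K} :=
    analyticSet_preimage_of_measurable hK.analytic (measurable_id.prodMk hlaw)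
  have hκ' := hκ.piecewise (measurableSet_analyticSigma hS)
    (hlaw.mono borel_le_analyticSigma le_rfl) fun _ hy ↦ hy
  refine ⟨_, hκ', hκ'.isComposition_iff.2 ?_⟩
  rw [← hsnd, ← bind_fst_condLaw, hfst]
  refine Measure.bind_congr_right (hae.mono fun y hy ↦ ?_)
  exact congrArg Subtype.val
    (piecewise_eq_of_mem {y | (y, condLaw (γ, y)) ∈ K} (fun y ↦ condLaw (γ, y)) κ hy).symm

theorem houseComp_eq_image [Nonempty E] (hK : IsHouse K) :
    houseComp J K =
      (fun p : E × ProbabilityMeasure (E × E) ↦ (p.1, p.2.map measurable_snd.aemeasurable)) ''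
        {p | (p.1, p.2.map measurable_fst.aemeasurable) ∈ J ∧
          ∀ᵐ y ∂(p.2 : Measure (E × E)).fst, (y, condLaw (p.2, y)) ∈ K} := by
  ext ⟨x, ν⟩
  simp only [houseComp, mem_ofPred_eq, mem_image, Prod.exists, Prod.mk.injEq]
  constructor
  · rintro ⟨μ, hμ, hν⟩
    obtain ⟨γ, hfst, hsnd, hae⟩ := exists_law_of_mem_measureComp hν
    have hγ : γ.map measurable_fst.aemeasurable = μ := Subtype.ext hfst
    exact ⟨x, γ, ⟨hγ.symm ▸ hμ, hfst.symm ▸ hae⟩, rfl, Subtype.ext hsnd⟩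
  · rintro ⟨x, γ, ⟨hx, hae⟩, rfl, rfl⟩
    exact ⟨_, hx, mem_measureComp_of_law hK rfl rfl hae⟩

theorem analyticSet_houseComp (hJ : AnalyticSet J) (hK : IsHouse K) :
    AnalyticSet (houseComp J K) := by
  cases isEmpty_or_nonempty E
  · exact eq_empty_of_isEmpty (houseComp J K) ▸ analyticSet_empty
  have hJ' : AnalyticSet {p : E × ProbabilityMeasure (E × E) |
      (p.1, p.2.map measurable_fst.aemeasurable) ∈ J} :=
    analyticSet_preimage_of_measurable hJ <| measurable_fst.prodMk
      ((measurable_probabilityMeasure_map measurable_fst).comp measurable_snd)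
  have hK' : AnalyticSet {p : ProbabilityMeasure (E × E) × E | (p.2, condLaw p) ∈ K} :=
    analyticSet_preimage_of_measurable hK.analytic (measurable_snd.prodMk measurable_condLaw)
  have hae : AnalyticSet {γ : ProbabilityMeasure (E × E) |
      ∀ᵐ y ∂(γ : Measure (E × E)).fst, (y, condLaw (γ, y)) ∈ K} := by
    have h := analyticSet_ae_mem hK' (Kernel.fst (evalKernel (E × E)))
    simp only [Kernel.fst_apply] at h
    exact h
  rw [houseComp_eq_image hK]
  exact analyticSet_image_of_measurable
    (analyticSet_inter hJ' (analyticSet_preimage_of_measurable hae measurable_snd))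
    (measurable_fst.prodMk ((measurable_probabilityMeasure_map measurable_snd).comp measurable_snd))

theorem IsHouse.houseComp (hJ : IsHouse J) (hK : IsHouse K) : IsHouse (houseComp J K) := by
  refine ⟨analyticSet_houseComp hJ.analytic hK, fun x ↦ ?_⟩
  obtain ⟨μ, hμ⟩ := hJ.nonempty_section x
  obtain ⟨κ, hκ⟩ := hK.exists_isAdmissible
  obtain ⟨ν, hν⟩ := hκ.exists_isComposition μ
  exact ⟨ν, μ, hμ, κ, hκ, hν⟩

theorem isHouse_houseCompSeq (n : ℕ) (J : Fin (n + 1) → Set (E × ProbabilityMeasure E))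
    (hJ : ∀ i, IsHouse (J i)) : IsHouse (houseCompSeq n J) := by
  induction n with
  | zero => exact hJ 0
  | succ n ih => exact (hJ 0).houseComp (ih _ fun i ↦ hJ i.succ)

theorem gain_houseCompSeq (n : ℕ) (J : Fin (n + 1) → Set (E × ProbabilityMeasure E))
    (hJ : ∀ i, IsHouse (J i)) {Φ : E → ℝ≥0∞} (hΦ : UpperSemianalytic fun x ↦ (Φ x : EReal)) :
    gain (houseCompSeq n J) Φ = gainSeq n J Φ := by
  induction n with
  | zero => rfl
  | succ n ih =>
    rw [houseCompSeq, gainSeq, ← ih _ fun i ↦ hJ i.succ]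
    exact (isHouse_houseCompSeq n _ fun i ↦ hJ i.succ).gain_houseComp hΦ

end Composition

end GamblingHouse

theorem mainTheorem6 {E : Type*} [TopologicalSpace E] [MeasurableSpace E] [BorelSpace E]
    (hE : GamblingHouse.IsBorelSubsetOfPolish E)
    (Φ : E → ℝ≥0∞) (hΦ : GamblingHouse.UpperSemianalytic (fun x => (Φ x : EReal))) :
    (∀ J : Set (E × ProbabilityMeasure E), GamblingHouse.IsHouse J →
      GamblingHouse.UpperSemianalytic (fun x => (GamblingHouse.gain J Φ x : EReal)) ∧
      ∀ m : ProbabilityMeasure E,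
        GamblingHouse.supPairing (GamblingHouse.measureComp m J) Φ =
          GamblingHouse.pairing m (GamblingHouse.gain J Φ)) ∧
    (∀ (n : ℕ) (J : Fin (n + 1) → Set (E × ProbabilityMeasure E)),
      (∀ i, GamblingHouse.IsHouse (J i)) →
      GamblingHouse.IsHouse (GamblingHouse.houseCompSeq n J) ∧
      GamblingHouse.gain (GamblingHouse.houseCompSeq n J) Φ = GamblingHouse.gainSeq n J Φ) := by
  obtain ⟨_, _, _⟩ := hE.standard
  exact ⟨fun J hJ ↦
      ⟨GamblingHouse.upperSemianalytic_gain hJ.analytic hΦ, hJ.supPairing_measureComp hΦ⟩,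
    fun n J hJ ↦
      ⟨GamblingHouse.isHouse_houseCompSeq n J hJ, GamblingHouse.gain_houseCompSeq n J hJ hΦ⟩⟩
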